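/- Let $V:\mathbb R\to\mathbb R$ be real analytic with $V(x)/\sqrt{x^2+1}\to+\infty$ as $|x|\to\infty$. Let $\mu$ be its equilibrium measure and $\ell$ its Robin constant, i.e. $\mu$ is the probability measure with finite logarithmic potential such that $2\int\log|x-s|\,d\mu(s)-V(x)=\ell$ for $x\in\operatorname{supp}\mu$ and $\le\ell$ for $x\notin\operatorname{supp}\mu$. Assume that $V$ is regular: there are $b_0<a_1<b_1<\dots<b_N<a_{N+1}$ and a real analytic function $h$ on $\mathbb R$ such that, with $J=\bigcup_{j=0}^N(b_j,a_{j+1})$ and $R(z)=\prod_{j=0}^N(z-b_j)(z-a_{j+1})$, the measure $\mu$ is carried by $J$ and has density $\Psi(x)=\frac1{2\pi i}R^{1/2}_+(x)h(x)\ge 0$ there, where $R^{1/2}_+$ is the boundary value from the upper half-plane of the branch of $R^{1/2}$ that is analytic in $\mathbb C\setminus\bar J$ with $R(z)^{1/2}\sim z^{N+1}$ as $z\to\infty$; moreover $h(x)\ne0$ for $x\in\bar J$, and the inequality above is strict for $x\in\mathbb R\setminus\bar J$. Let $\mathbf e=\max\operatorname{supp}\mu$ and $\mathbf g(x)=\int\log(x-s)\,d\mu(s)$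 for $x\ge\mathbf e$. For $0<a<\frac12V'(\mathbf e)$ let $c(a)$ be the unique point in $(\mathbf e,\infty)$ with $\mathbf g'(c(a))=a$, and for $a\ge\frac12V'(\mathbf e)$ let $c(a)=\mathbf e$. Put $$\mathbf G(x;a)=\mathbf g(x)-V(x)+ax,\qquad \mathbf H(x;a)=-\mathbf g(x)+ax+\ell ,$$ $$\mathcal A_V=\{a\in(0,\infty):\ \mathbf G(\bar x;a)>\mathbf H(c(a);a)\text{ for some }\bar x\in(c(a),\infty)\},\qquad \mathbf a_c=\inf\mathcal A_V .$$ Then: (a) $(\frac12V'(\mathbf e),\infty)\subset\mathcal A_V$; hence $\mathbf a_c\le\frac12V'(\mathbf e)$. (b) $\mathcal A_V=(\mathbf a_c,\infty)$. (c) $\mathbf a_c>0$. (d) If $0<a<\mathbf a_c$, then $\mathbf G(x;a)<\mathbf H(c(a);a)$ for all $x\in(c(a),\infty)$. (e) If $V$ is convex on $[\mathbf e,\infty)$, then $\mathbf a_c=\frac12V'(\mathbf e)$ and $\mathbf G(x;\mathbf a_c)<\mathbf H(\mathbf e;\mathbf a_c)$ for all $x>\mathbf e$; moreover, in this case $c(\mathbf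 a_c)=\mathbf e$ and $\mathbf G(\mathbf e;\mathbf a_c)=\mathbf H(\mathbf e;\mathbf a_c)$. (f) If $\mathbf a_c<\frac12V'(\mathbf e)$, then $\mathbf G(x;\mathbf a_c)\le\mathbf H(c(\mathbf a_c);\mathbf a_c)$ for all $x\in(c(\mathbf a_c),\infty)$, and equality holds for at least one such $x$. -/

import Mathlib

open MeasureTheory Set Filter Topology

noncomputable section

namespace SpikedSource

/-- The logarithmic potential `x ↦ ∫ log |x - s| dμ(s)` of a measure `μ` on the real line. -/
def logPotential (μ : Measure ℝ) (x : ℝ) : ℝ :=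
  ∫ s, Real.log |x - s| ∂μ

/-- `μ` is the equilibrium measure of the external potential `V`, with Robin constant `ℓ`:
a probability measure with finite logarithmic potential that satisfies the Euler-Lagrange
variational conditions. Atoms are excluded explicitly because `Real.log 0 = 0` in Mathlib; with
`noAtoms` and `integrable_log` the logarithmic potential is a genuine finite integral at every
point. -/
structure IsEquilibriumMeasure (V : ℝ → ℝ) (μ : Measure ℝ) (ℓ : ℝ) : Prop where
  isProbabilityMeasure : IsProbabilityMeasure μ
  noAtoms : ∀ x : ℝ, μ {x} = 0
  integrable_log : ∀ x : ℝ, Integrable (fun s => Real.log |x - s|) μ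
  eq_on_support : ∀ x ∈ μ.support, 2 * logPotential μ x - V x = ℓ
  le_off_support : ∀ x ∉ μ.support, 2 * logPotential μ x - V x ≤ ℓ

/-- The union `J` of the open bands `(b j, a j)`, where `j = 0, …, N`. -/
def bands {N : ℕ} (b a : Fin (N + 1) → ℝ) : Set ℝ :=
  ⋃ j, Ioo (b j) (a j)

/-- The square root `R(z)^{1/2}` of `R(z) = ∏ j, (z - b j) (z - a j)` that is analytic off the
closed bands and asymptotic to `z ^ (N + 1)` at infinity. The power is Mathlib's principal one,
which is continuous from above on the negative real axis, so for a real number `x` in a band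
`sqrtR b a x` is the boundary value `R^{1/2}_+(x)` from the upper half-plane. -/
def sqrtR {N : ℕ} (b a : Fin (N + 1) → ℝ) (z : ℂ) : ℂ :=
  ∏ j, (z - (b j : ℂ)) ^ (1 / 2 : ℂ) * (z - (a j : ℂ)) ^ (1 / 2 : ℂ)

/-- `μ` is carried by the bands `b 0 < a 0 < b 1 < a 1 < … < b N < a N` and has there the density
`Ψ(x) = (2 π i)⁻¹ R^{1/2}_+(x) h(x)` with `h` real analytic on the real line. -/
structure HasBandDensity (μ : Measure ℝ) {N : ℕ} (b a : Fin (N + 1) → ℝ) (h Ψ : ℝ → ℝ) :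
    Prop where
  left_lt_right : ∀ j, b j < a j
  right_lt_left : ∀ i j, i < j → a i < b j
  analytic : AnalyticOnNhd ℝ h univ
  nonneg : ∀ x ∈ bands b a, 0 ≤ Ψ x
  formula : ∀ x ∈ bands b a,
    (Ψ x : ℂ) = 1 / (2 * (Real.pi : ℂ) * Complex.I) * sqrtR b a (x : ℂ) * (h x : ℂ)
  measure_eq : μ = (volume.restrict (bands b a)).withDensity (fun x => ENNReal.ofReal (Ψ x))

/-- The potential `V`, with equilibrium measure `μ` and Robin constant `ℓ`, is regular: in the
representation of the density of `μ`, the function `h` does not vanish on the closed bands, and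
the variational inequality is strict off the closed bands. -/
def IsRegular (V : ℝ → ℝ) (μ : Measure ℝ) (ℓ : ℝ) : Prop :=
  ∃ (N : ℕ) (b a : Fin (N + 1) → ℝ) (h Ψ : ℝ → ℝ),
    HasBandDensity μ b a h Ψ ∧
    (∀ x ∈ closure (bands b a), h x ≠ 0) ∧
    (∀ x ∉ closure (bands b a), 2 * logPotential μ x - V x < ℓ)

/-- The right-most edge `e` of the support of `μ`. -/
def rightEdge (μ : Measure ℝ) : ℝ :=
  sSup μ.support

/-- The function `g(x) = ∫ log (x - s) dμ(s)`, on the real half-line `x ≥ e`. -/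
def gFun (μ : Measure ℝ) (x : ℝ) : ℝ :=
  ∫ s, Real.log (x - s) ∂μ

open Classical in
/-- The point `c(a)`: for `0 < a < V'(e) / 2` it is the unique point of `(e, ∞)` at which the
derivative of `g` equals `a`, and for `a ≥ V'(e) / 2` it is `e`. -/
def cPoint (V : ℝ → ℝ) (μ : Measure ℝ) (a : ℝ) : ℝ :=
  if a < deriv V (rightEdge μ) / 2 then
    Classical.epsilon (fun x : ℝ => rightEdge μ < x ∧ deriv (gFun μ) x = a)
  else rightEdge μ

/-- The function `G(x; a) = g(x) - V(x) + a x`. -/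
def GFun (V : ℝ → ℝ) (μ : Measure ℝ) (x a : ℝ) : ℝ :=
  gFun μ x - V x + a * x

/-- The function `H(x; a) = -g(x) + a x + ℓ`. -/
def HFun (μ : Measure ℝ) (ℓ : ℝ) (x a : ℝ) : ℝ :=
  -gFun μ x + a * x + ℓ

/-- The set `𝒜_V` of all `a > 0` such that `G(x; a) > H(c(a); a)` for some `x > c(a)`. -/
def setA (V : ℝ → ℝ) (μ : Measure ℝ) (ℓ : ℝ) : Set ℝ :=
  {a | 0 < a ∧ ∃ x, cPoint V μ a < x ∧ HFun μ ℓ (cPoint V μ a) a < GFun V μ x a}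

/-- The critical value `a_c = inf 𝒜_V`. -/
def aCrit (V : ℝ → ℝ) (μ : Measure ℝ) (ℓ : ℝ) : ℝ :=
  sInf (setA V μ ℓ)

end SpikedSource

end

/-! Only the behaviour on `[e, ∞)` matters for (a)-(f), and `SoftEdge` isolates it: `g` is concave
with slope `q` decreasing strictly from `V'(e) / 2` to `0`. Hence `c(a)` minimises `H(·; a)` on `[e,
∞)`, and `c(a) < x` means `e < x` and `q x < a`. So `c(a)` can be eliminated from the definition of
`𝒜_V` (`mem_setA_iff`): membership asks for points `x`, `y` satisfying strict inequalities that
depend continuously on `a`, which makes `𝒜_V` open. It is closed under increasing `a`, because `G(x;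
a) - H(c; a)` has slope `x - c > 0` in `a`. Thus `𝒜_V` is an open ray. Superlinear growth of `V`
excludes small `a` and bounds the witnesses `x`; when `a_c < V'(e) / 2`, witnesses for `a ↓ a_c`
accumulate at a point of equality.

The analytic input is `q e = V'(e) / 2` (`stieltjes_edge`), where `q` is the Stieltjes transform.
The density of `μ` is at most `C √(e - s)`, so `q e` is finite. The variational inequality to the
right of `e` gives `q e ≤ V'(e) / 2`; the equality in the last band, with an error `O(t ^ (5/4))` in
the potential at `e - t`, gives the converse. -/

namespace SpikedSource

/-! ### Concave functions at a soft edge -/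

/-- The properties near and to the right of a soft edge `e` of a potential-theoretic function `g`
with derivative `q`: `g` is concave on `[e, ∞)` with slopes `q` decreasing to `0`, and the
variational conditions with external field `V` and constant `ℓ` hold on `[e, ∞)`. -/
structure SoftEdge (V g q : ℝ → ℝ) (e ℓ : ℝ) : Prop where
  slope_pos : ∀ x, e ≤ x → 0 < q x
  slope_anti : StrictAntiOn q (Ici e)
  slope_cont : ContinuousOn q (Ici e)
  slope_tendsto : Tendsto q atTop (𝓝 0)
  le_secant : ∀ x y, e ≤ y → y < x → (x - y) * q x ≤ g x - g y
  secant_le : ∀ x y, e ≤ y → y < x → g x - g y ≤ (x - y) * q y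
  slope_edge : q e = deriv V e / 2
  eq_edge : 2 * g e - V e = ℓ
  lt_off_edge : ∀ x, e < x → 2 * g x - V x < ℓ
  differentiable : Differentiable ℝ V
  growth : ∀ M, ∀ᶠ x in atTop, M * x ≤ V x

namespace SoftEdge

variable {V g q : ℝ → ℝ} {e ℓ : ℝ}

/-- The two secant bounds trap the difference quotient between the slopes at its endpoints, and
continuity of `q` squeezes it. -/
theorem hasDerivAt (h : SoftEdge V g q e ℓ) {x : ℝ} (hx : e < x) : HasDerivAt g (q x) x := by
  have hq : Tendsto q (𝓝[≠] x) (𝓝 (q x)) :=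
    ((h.slope_cont.continuousAt (Ici_mem_nhds hx)).tendsto).mono_left nhdsWithin_le_nhds
  rw [hasDerivAt_iff_tendsto_slope]
  have hmin : Tendsto (fun y => min (q x) (q y)) (𝓝[≠] x) (𝓝 (q x)) := by
    simpa using (tendsto_const_nhds (x := q x)).min hq
  have hmax : Tendsto (fun y => max (q x) (q y)) (𝓝[≠] x) (𝓝 (q x)) := by
    simpa using (tendsto_const_nhds (x := q x)).max hq
  have hev : ∀ᶠ y in 𝓝[≠] x, e < y ∧ y ≠ x :=
    (eventually_nhdsWithin_of_eventually_nhds (eventually_gt_nhds hx)).and self_mem_nhdsWithin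
  have key : ∀ y, e < y → y ≠ x → min (q x) (q y) ≤ slope g x y ∧
      slope g x y ≤ max (q x) (q y) := by
    intro y hy hyx
    rw [slope_def_field]
    rcases lt_or_gt_of_ne hyx with hlt | hlt
    · have h1 := h.le_secant x y hy.le hlt
      have h2 := h.secant_le x y hy.le hlt
      have h3 : 0 < x - y := sub_pos.2 hlt
      have h4 : (g y - g x) / (y - x) = (g x - g y) / (x - y) := by
        rw [← neg_sub (g x), ← neg_sub x, neg_div_neg_eq]
      rw [h4]
      exact ⟨(min_le_left _ _).trans ((le_div_iff₀ h3).2 (by linarith)),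
        ((div_le_iff₀ h3).2 (by linarith)).trans (le_max_right _ _)⟩
    · have h1 := h.le_secant y x hx.le hlt
      have h2 := h.secant_le y x hx.le hlt
      have h3 : 0 < y - x := sub_pos.2 hlt
      exact ⟨(min_le_right _ _).trans ((le_div_iff₀ h3).2 (by linarith)),
        ((div_le_iff₀ h3).2 (by linarith)).trans (le_max_left _ _)⟩
  exact tendsto_of_tendsto_of_tendsto_of_le_of_le' hmin hmax
    (hev.mono fun y hy => (key y hy.1 hy.2).1) (hev.mono fun y hy => (key y hy.1 hy.2).2)

theorem secant_lt (h : SoftEdge V g q e ℓ) {x y : ℝ} (hy : e ≤ y) (hxy : y < x) :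
    g x - g y < (x - y) * q y := by
  obtain ⟨m, hym, hmx⟩ := exists_between hxy
  have h1 := h.secant_le x m (hy.trans hym.le) hmx
  have h2 := h.secant_le m y hy hym
  have h3 : q m < q y := h.slope_anti hy (hy.trans hym.le) hym
  nlinarith [mul_lt_mul_of_pos_left h3 (sub_pos.2 hmx)]

theorem continuousAt (h : SoftEdge V g q e ℓ) {x : ℝ} (hx : e < x) : ContinuousAt g x :=
  (h.hasDerivAt hx).continuousAt

theorem exists_slope_eq (h : SoftEdge V g q e ℓ) {a : ℝ} (ha : 0 < a) (hae : a < q e) :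
    ∃ c, e < c ∧ q c = a := by
  obtain ⟨X, hX, heX⟩ := ((h.slope_tendsto.eventually_lt_const ha).and (eventually_gt_atTop e)).exists
  obtain ⟨c, hc, hqc⟩ := intermediate_value_Icc' heX.le
    (h.slope_cont.mono Icc_subset_Ici_self) ⟨hX.le, hae.le⟩
  refine ⟨c, lt_of_le_of_ne hc.1 ?_, hqc⟩
  rintro rfl
  exact hae.ne' hqc

/-- Eventually `g` and `V` are compared with a linear function of any slope. -/
theorem eventually_lt (h : SoftEdge V g q e ℓ) (k A B : ℝ) (hk : 0 ≤ k) :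
    ∀ᶠ x in atTop, k * g x - V x + A * x < B := by
  have h1 := h.growth (A + k * q e + 1)
  filter_upwards [h1, eventually_gt_atTop e,
    eventually_gt_atTop (k * (g e - e * q e) - B)] with x hx hex hxB
  have h2 := mul_le_mul_of_nonneg_left (h.secant_le x e le_rfl hex) hk
  nlinarith

end SoftEdge

/-! ### The set `𝒜_V` and the critical value -/

/-- `SoftEdge` for the function `g` and the right-most edge of a measure. -/
abbrev IsSoftEdge (V : ℝ → ℝ) (μ : Measure ℝ) (q : ℝ → ℝ) (ℓ : ℝ) : Prop :=
  SoftEdge V (gFun μ) q (rightEdge μ) ℓ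

namespace SoftEdge

variable {V q : ℝ → ℝ} {μ : Measure ℝ} {ℓ : ℝ}

theorem cPoint_spec (h : IsSoftEdge V μ q ℓ) {a : ℝ} (ha : 0 < a) (hae : a < q (rightEdge μ)) :
    rightEdge μ < cPoint V μ a ∧ q (cPoint V μ a) = a := by
  obtain ⟨c, hc, hqc⟩ := h.exists_slope_eq ha hae
  have hex : ∃ x : ℝ, rightEdge μ < x ∧ deriv (gFun μ) x = a :=
    ⟨c, hc, (h.hasDerivAt hc).deriv.trans hqc⟩
  have := Classical.epsilon_spec hex
  rw [cPoint, if_pos (h.slope_edge ▸ hae)]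
  exact ⟨this.1, (h.hasDerivAt this.1).deriv.symm.trans this.2⟩

theorem cPoint_eq (h : IsSoftEdge V μ q ℓ) {a : ℝ} (hae : q (rightEdge μ) ≤ a) :
    cPoint V μ a = rightEdge μ := by
  rw [cPoint, if_neg (not_lt.2 (h.slope_edge ▸ hae))]

theorem edge_le_cPoint (h : IsSoftEdge V μ q ℓ) {a : ℝ} (ha : 0 < a) :
    rightEdge μ ≤ cPoint V μ a := by
  rcases lt_or_ge a (q (rightEdge μ)) with hae | hae
  · exact (h.cPoint_spec ha hae).1.le
  · exact (h.cPoint_eq hae).ge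

/-- Strict monotonicity of `q` trades the implicitly defined `c(a)` for a condition that is visibly
open and monotone in `a`. -/
theorem cPoint_lt_iff (h : IsSoftEdge V μ q ℓ) {a x : ℝ} (ha : 0 < a) :
    cPoint V μ a < x ↔ rightEdge μ < x ∧ q x < a := by
  rcases lt_or_ge a (q (rightEdge μ)) with hae | hae
  · obtain ⟨h1, h2⟩ := h.cPoint_spec ha hae
    constructor
    · intro hx
      exact ⟨h1.trans hx, h2 ▸ h.slope_anti h1.le (h1.trans hx).le hx⟩
    · rintro ⟨hx, hq⟩
      exact (h.slope_anti.lt_iff_gt hx.le h1.le).1 (h2.symm ▸ hq)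
  · rw [h.cPoint_eq hae]
    exact ⟨fun hx => ⟨hx, (h.slope_anti self_mem_Ici hx.le hx).trans_le hae⟩, And.left⟩

theorem slope_cPoint_le (h : IsSoftEdge V μ q ℓ) {a : ℝ} (ha : 0 < a) :
    q (cPoint V μ a) ≤ a := by
  rcases lt_or_ge a (q (rightEdge μ)) with hae | hae
  · exact (h.cPoint_spec ha hae).2.le
  · rwa [h.cPoint_eq hae]

/-- `H(·; a)` attains its minimum over `[e, ∞)` at `c(a)`. -/
theorem HFun_cPoint_le (h : IsSoftEdge V μ q ℓ) {a y : ℝ} (ha : 0 < a) (hy : rightEdge μ ≤ y) :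
    HFun μ ℓ (cPoint V μ a) a ≤ HFun μ ℓ y a := by
  have hc := h.edge_le_cPoint ha
  unfold HFun
  rcases lt_trichotomy y (cPoint V μ a) with hlt | rfl | hlt
  · have hae : a < q (rightEdge μ) := by
      by_contra hae
      exact hlt.not_ge ((h.cPoint_eq (not_lt.1 hae)).trans_le hy)
    have h1 := h.le_secant _ _ hy hlt
    rw [(h.cPoint_spec ha hae).2] at h1
    linarith
  · rfl
  · have h1 := h.secant_le _ _ hc hlt
    have h2 := mul_le_mul_of_nonneg_left (h.slope_cPoint_le ha) (sub_pos.2 hlt).le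
    linarith

/-- Since `c(a)` minimises `H(·; a)`, exceeding `H` at some `y ≥ e` already means exceeding it at
`c(a)`. Freeing `y` from `a` makes perturbation in `a` immediate. -/
theorem mem_setA_iff (h : IsSoftEdge V μ q ℓ) {a : ℝ} :
    a ∈ setA V μ ℓ ↔ 0 < a ∧ ∃ x y, rightEdge μ < x ∧ q x < a ∧ rightEdge μ ≤ y ∧
      HFun μ ℓ y a < GFun V μ x a := by
  constructor
  · rintro ⟨ha, x, hx, hlt⟩
    obtain ⟨h1, h2⟩ := (h.cPoint_lt_iff ha).1 hx
    exact ⟨ha, x, _, h1, h2, h.edge_le_cPoint ha, hlt⟩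
  · rintro ⟨ha, x, y, hx, hq, hy, hlt⟩
    exact ⟨ha, x, (h.cPoint_lt_iff ha).2 ⟨hx, hq⟩, (h.HFun_cPoint_le ha hy).trans_lt hlt⟩

/-- If `G(x; a) ≥ H(c(a); a)` for some `x > c(a)`, then every larger parameter is in `𝒜_V`. -/
theorem mem_setA_of_lt (h : IsSoftEdge V μ q ℓ) {a a' x : ℝ} (ha : 0 < a) (haa : a < a')
    (hx : cPoint V μ a < x) (hle : HFun μ ℓ (cPoint V μ a) a ≤ GFun V μ x a) :
    a' ∈ setA V μ ℓ := by
  obtain ⟨h1, h2⟩ := (h.cPoint_lt_iff ha).1 hx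
  refine h.mem_setA_iff.2
    ⟨ha.trans haa, x, _, h1, h2.trans haa, h.edge_le_cPoint ha, ?_⟩
  unfold HFun GFun at *
  -- From `a` to `a'`, with `c(a)` kept as `y`, `G` gains `(a' - a) x` and `H` only `(a' - a) c(a)`.
  nlinarith [mul_pos (sub_pos.2 haa) (sub_pos.2 hx)]

theorem isOpen_setA (h : IsSoftEdge V μ q ℓ) : IsOpen (setA V μ ℓ) := by
  rw [isOpen_iff_mem_nhds]
  intro a ha
  obtain ⟨ha0, x, y, hx, hq, hy, hlt⟩ := h.mem_setA_iff.1 ha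
  have hcont : ContinuousAt (fun a => GFun V μ x a - HFun μ ℓ y a) a := by
    unfold GFun HFun; fun_prop
  filter_upwards [Ioi_mem_nhds ha0, Ioi_mem_nhds hq,
    hcont.eventually_const_lt (sub_pos.2 hlt)] with a' h1 h2 h3
  exact h.mem_setA_iff.2 ⟨h1, x, y, hx, h2, hy, sub_pos.1 h3⟩

/-- At `e` one has `G = H`, and `G(·; a)` leaves `e` with right slope `q e - V'(e) + a = a - V'(e) /
2 > 0`. -/
theorem Ioi_subset_setA (h : IsSoftEdge V μ q ℓ) :
    Ioi (deriv V (rightEdge μ) / 2) ⊆ setA V μ ℓ := by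
  intro a ha
  set e := rightEdge μ with he
  have hqe : q e < a := h.slope_edge ▸ ha
  have hVs : Tendsto (slope V e) (𝓝[>] e) (𝓝 (deriv V e)) :=
    ((hasDerivAt_iff_tendsto_slope.1 (h.differentiable e).hasDerivAt)).mono_left
      (nhdsWithin_mono _ fun x hx => ne_of_gt hx)
  have hqs : Tendsto q (𝓝[>] e) (𝓝 (q e)) :=
    (h.slope_cont e self_mem_Ici).mono_left (nhdsWithin_mono _ Ioi_subset_Ici_self)
  have hlim := (hqs.sub hVs).add_const a
  have hpos : 0 < q e - deriv V e + a := by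
    have := h.slope_edge; rw [← he] at this; linarith
  obtain ⟨x, hx, hex⟩ := ((hlim.eventually_const_lt hpos).and self_mem_nhdsWithin).exists
  replace hex : e < x := hex
  refine h.mem_setA_iff.2 ⟨(h.slope_pos e le_rfl).trans hqe, x, e, hex,
    (h.slope_anti self_mem_Ici hex.le hex).trans hqe, le_rfl, ?_⟩
  have h1 := h.le_secant x e le_rfl hex
  have h2 := h.eq_edge
  have hsl : slope V e x * (x - e) = V x - V e := by
    rw [slope_def_field, div_mul_cancel₀ _ (sub_pos.2 hex).ne']
  have h3 := mul_pos hx (sub_pos.2 hex)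
  rw [← he] at h2
  unfold GFun HFun
  nlinarith

/-- For small `a` the point `c(a)` is far out. There `g(c(a)) ≤ g x` gives `G(x; a) - H(c(a); a) ≤ 2
g x - V x + x - ℓ`, which growth makes negative. -/
theorem exists_pos_le_of_mem_setA (h : IsSoftEdge V μ q ℓ) :
    ∃ δ, 0 < δ ∧ ∀ a ∈ setA V μ ℓ, δ ≤ a := by
  set e := rightEdge μ
  obtain ⟨X₀, hX₀⟩ := eventually_atTop.1 (h.eventually_lt 2 1 ℓ zero_le_two)
  set X := max (max X₀ 0) e
  have hX0 : 0 ≤ X := (le_max_right _ _).trans (le_max_left _ _)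
  have hXe : e ≤ X := le_max_right _ _
  -- The bound `a < q X` forces `X ≤ c(a)`, while `a < 1` gives `a x ≤ x`.
  refine ⟨min 1 (q X), lt_min one_pos (h.slope_pos X hXe), ?_⟩
  rintro a ⟨ha, x, hx, hlt⟩
  by_contra hcon
  obtain ⟨ha1, haq⟩ := lt_min_iff.1 (not_le.1 hcon)
  have hc : X ≤ cPoint V μ a := by
    by_contra hc
    exact haq.not_ge ((h.cPoint_lt_iff ha).1 (not_le.1 hc)).2.le
  have h1 := hX₀ x (((le_max_left _ _).trans (le_max_left _ _)).trans (hc.trans hx.le))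
  have h2 := h.le_secant x _ (h.edge_le_cPoint ha) hx
  have h3 := h.slope_pos x ((h.edge_le_cPoint ha).trans hx.le)
  have h4 := mul_pos (sub_pos.2 hx) h3
  have h5 : 0 ≤ a * cPoint V μ a := mul_nonneg ha.le (hX0.trans hc)
  have h6 : a * x ≤ 1 * x := mul_le_mul_of_nonneg_right ha1.le (hX0.trans (hc.trans hx.le))
  unfold HFun GFun at hlt
  linarith

theorem bddBelow_setA : BddBelow (setA V μ ℓ) := ⟨0, fun _ ha => ha.1.le⟩

theorem setA_nonempty (h : IsSoftEdge V μ q ℓ) : (setA V μ ℓ).Nonempty :=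
  nonempty_Ioi.mono h.Ioi_subset_setA

theorem aCrit_pos (h : IsSoftEdge V μ q ℓ) : 0 < aCrit V μ ℓ := by
  obtain ⟨δ, hδ, hle⟩ := h.exists_pos_le_of_mem_setA
  exact hδ.trans_le (le_csInf h.setA_nonempty hle)

theorem aCrit_le (h : IsSoftEdge V μ q ℓ) : aCrit V μ ℓ ≤ deriv V (rightEdge μ) / 2 :=
  le_of_forall_gt_imp_ge_of_dense fun _ ha => csInf_le bddBelow_setA (h.Ioi_subset_setA ha)

theorem aCrit_notMem (h : IsSoftEdge V μ q ℓ) : aCrit V μ ℓ ∉ setA V μ ℓ := by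
  intro hmem
  obtain ⟨a, ha, hsub⟩ := exists_Ioc_subset_of_mem_nhds (h.isOpen_setA.mem_nhds hmem)
    ⟨_, sub_one_lt _⟩
  obtain ⟨a', h1, h2⟩ := exists_between ha
  exact h2.not_ge (csInf_le bddBelow_setA (hsub ⟨h1, h2.le⟩))

theorem setA_eq_Ioi (h : IsSoftEdge V μ q ℓ) : setA V μ ℓ = Ioi (aCrit V μ ℓ) := by
  ext a
  constructor
  · intro ha
    refine lt_of_le_of_ne (csInf_le bddBelow_setA ha) ?_
    rintro rfl
    exact h.aCrit_notMem ha
  · intro ha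
    obtain ⟨a₀, ⟨h0, x, hx, hlt⟩, ha₀⟩ := exists_lt_of_csInf_lt h.setA_nonempty ha
    exact h.mem_setA_of_lt h0 ha₀ hx hlt.le

theorem GFun_lt_of_lt_aCrit (h : IsSoftEdge V μ q ℓ) {a x : ℝ} (ha : 0 < a)
    (hac : a < aCrit V μ ℓ) (hx : cPoint V μ a < x) :
    GFun V μ x a < HFun μ ℓ (cPoint V μ a) a := by
  by_contra hcon
  obtain ⟨a', h1, h2⟩ := exists_between hac
  exact h2.not_ge (csInf_le bddBelow_setA (h.mem_setA_of_lt ha h1 hx (not_lt.1 hcon)))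

theorem GFun_edge (h : IsSoftEdge V μ q ℓ) (a : ℝ) :
    GFun V μ (rightEdge μ) a = HFun μ ℓ (rightEdge μ) a := by
  have := h.eq_edge
  unfold GFun HFun
  linarith

/-- The tangent of `V` at `e` lies below `V` and that of `g` strictly above `g`; at `a = V'(e) / 2`
the linear terms cancel. -/
theorem GFun_lt_of_convexOn (h : IsSoftEdge V μ q ℓ) (hV : ConvexOn ℝ (Ici (rightEdge μ)) V)
    {x : ℝ} (hx : rightEdge μ < x) :
    GFun V μ x (deriv V (rightEdge μ) / 2) <
      HFun μ ℓ (rightEdge μ) (deriv V (rightEdge μ) / 2) := by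
  have h1 := h.secant_lt le_rfl hx
  have h2 := hV.le_slope_of_hasDerivAt self_mem_Ici hx.le hx
    (h.differentiable _).hasDerivAt
  rw [slope_def_field, le_div_iff₀ (sub_pos.2 hx)] at h2
  have h3 := h.eq_edge
  rw [h.slope_edge] at h1
  unfold GFun HFun
  linarith

theorem aCrit_eq_of_convexOn (h : IsSoftEdge V μ q ℓ)
    (hV : ConvexOn ℝ (Ici (rightEdge μ)) V) :
    aCrit V μ ℓ = deriv V (rightEdge μ) / 2 := by
  refine h.aCrit_le.antisymm (not_lt.1 fun hlt => ?_)
  have hmem : deriv V (rightEdge μ) / 2 ∈ setA V μ ℓ := h.setA_eq_Ioi ▸ hlt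
  obtain ⟨-, x, hx, hlt⟩ := hmem
  rw [h.cPoint_eq h.slope_edge.le] at hx hlt
  exact (h.GFun_lt_of_convexOn hV hx).not_gt hlt

theorem GFun_aCrit_le (h : IsSoftEdge V μ q ℓ) {x : ℝ} (hx : cPoint V μ (aCrit V μ ℓ) < x) :
    GFun V μ x (aCrit V μ ℓ) ≤ HFun μ ℓ (cPoint V μ (aCrit V μ ℓ)) (aCrit V μ ℓ) :=
  not_lt.1 fun hlt => h.aCrit_notMem ⟨h.aCrit_pos, x, hx, hlt⟩

theorem exists_GFun_aCrit_eq (h : IsSoftEdge V μ q ℓ)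
    (hlt : aCrit V μ ℓ < deriv V (rightEdge μ) / 2) :
    ∃ x, cPoint V μ (aCrit V μ ℓ) < x ∧
      GFun V μ x (aCrit V μ ℓ) = HFun μ ℓ (cPoint V μ (aCrit V μ ℓ)) (aCrit V μ ℓ) := by
  set e := rightEdge μ with he
  set a₀ := aCrit V μ ℓ with ha₀
  set c₀ := cPoint V μ a₀
  rw [← h.slope_edge] at hlt
  have ha₀pos : 0 < a₀ := h.aCrit_pos
  obtain ⟨hec, hqc⟩ := h.cPoint_spec ha₀pos hlt
  -- An upper bound `a₁ < q e` for the parameters keeps all witnesses to the right of `c₁ > e`, so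
  -- that their limit stays off the edge.
  obtain ⟨a₁, h01, h1q⟩ := exists_between hlt
  obtain ⟨hec₁, hqc₁⟩ := h.cPoint_spec (ha₀pos.trans h01) h1q
  set c₁ := cPoint V μ a₁
  obtain ⟨u, -, hu, hulim⟩ := exists_seq_strictAnti_tendsto' h01
  have hmem : ∀ n, u n ∈ setA V μ ℓ := fun n => by
    rw [h.setA_eq_Ioi]; exact (hu n).1
  choose hupos x hx hHG using hmem
  have hxe : ∀ n, e < x n ∧ q (x n) < u n := fun n => (h.cPoint_lt_iff (hupos n)).1 (hx n)
  have hlow : ∀ n, c₁ ≤ x n := fun n => by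
    have := (h.cPoint_lt_iff (ha₀pos.trans h01)).2 ⟨(hxe n).1, (hxe n).2.trans (hu n).2⟩
    exact this.le
  -- `H(c(u n); u n) = H(c(u n); a₀) + (u n - a₀) c(u n)`; the first term is minimal at `c₀`, and
  -- `c(u n) ≥ e`. This avoids any continuity of `c`.
  have hG : ∀ n, HFun μ ℓ c₀ a₀ + (u n - a₀) * e < GFun V μ (x n) (u n) := fun n => by
    refine lt_of_le_of_lt ?_ (hHG n)
    have h1 := h.HFun_cPoint_le ha₀pos (h.edge_le_cPoint (hupos n))
    have h2 := mul_le_mul_of_nonneg_left (h.edge_le_cPoint (hupos n)) (sub_pos.2 (hu n).1).le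
    change HFun μ ℓ c₀ a₀ ≤ _ at h1
    unfold HFun at *
    linarith
  obtain ⟨X, hX⟩ := eventually_atTop.1
    (h.eventually_lt 1 a₁ (HFun μ ℓ c₀ a₀ - (a₁ - a₀) * |e|) zero_le_one)
  set Y := max X 0
  have hupp : ∀ n, x n ≤ Y := fun n => by
    by_contra hcon
    have hYx := not_le.1 hcon
    have h1 := hX (x n) ((le_max_left _ _).trans hYx.le)
    have h2 := hG n
    have h3 : u n * x n ≤ a₁ * x n :=
      mul_le_mul_of_nonneg_right (hu n).2.le ((le_max_right _ _).trans hYx.le)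
    have h4 : -((a₁ - a₀) * |e|) ≤ (u n - a₀) * e := by
      have h5 : (u n - a₀) * -|e| ≤ (u n - a₀) * e :=
        mul_le_mul_of_nonneg_left (neg_abs_le e) (sub_pos.2 (hu n).1).le
      have h6 : (u n - a₀) * |e| ≤ (a₁ - a₀) * |e| :=
        mul_le_mul_of_nonneg_right (by linarith [(hu n).2]) (abs_nonneg e)
      linarith
    unfold GFun at h2
    linarith
  obtain ⟨z, hz, φ, hφ, hxz⟩ := isCompact_Icc.tendsto_subseq fun n => ⟨hlow n, hupp n⟩
  have hez : e < z := lt_of_lt_of_le hec₁ hz.1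
  have huφ : Tendsto (u ∘ φ) atTop (𝓝 a₀) := hulim.comp hφ.tendsto_atTop
  have hqz : q z ≤ a₀ :=
    le_of_tendsto_of_tendsto
      (((h.slope_cont.continuousAt (Ici_mem_nhds hez)).tendsto).comp hxz) huφ
      (Eventually.of_forall fun n => (hxe (φ n)).2.le)
  have hGz : HFun μ ℓ c₀ a₀ ≤ GFun V μ z a₀ := by
    have hL : Tendsto (fun n => HFun μ ℓ c₀ a₀ + ((u ∘ φ) n - a₀) * e) atTop
        (𝓝 (HFun μ ℓ c₀ a₀)) := by
      simpa using ((huφ.sub_const a₀).mul_const e).const_add (HFun μ ℓ c₀ a₀)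
    have hR : Tendsto (fun n => GFun V μ ((x ∘ φ) n) ((u ∘ φ) n)) atTop (𝓝 (GFun V μ z a₀)) :=
      ((((h.continuousAt hez).tendsto.comp hxz).sub
        ((h.differentiable z).continuousAt.tendsto.comp hxz))).add (huφ.mul hxz)
    exact le_of_tendsto_of_tendsto hL hR (Eventually.of_forall fun n => (hG (φ n)).le)
  -- The limit is not `c₀`: as `c₀ > e`, the strict variational inequality gives `G(c₀; a₀) < H(c₀;
  -- a₀)`.
  have hcz : c₀ < z := by
    have hle : c₀ ≤ z := (h.slope_anti.le_iff_ge hez.le hec.le).1 (hqc.symm ▸ hqz)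
    refine lt_of_le_of_ne hle ?_
    intro hcz
    rw [← hcz] at hGz
    have := h.lt_off_edge c₀ hec
    unfold HFun GFun at hGz
    linarith
  exact ⟨z, hcz, (h.GFun_aCrit_le hcz).antisymm hGz⟩

end SoftEdge

/-! ### Potential estimate at a square-root edge -/

/-- The measure on `(B, e)` with density `C √(e - s)`. -/
noncomputable def sqrtEdgeMeasure (B e C : ℝ) : Measure ℝ :=
  (volume.restrict (Ioo B e)).withDensity fun s => ENNReal.ofReal (C * √(e - s))

theorem measurable_sqrtEdge (e C : ℝ) :
    Measurable fun s : ℝ => ENNReal.ofReal (C * √(e - s)) := by fun_prop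

theorem ae_sqrtEdgeMeasure {B e C : ℝ} {p : ℝ → Prop}
    (h : ∀ᵐ s ∂(volume.restrict (Ioo B e)), p s) : ∀ᵐ s ∂(sqrtEdgeMeasure B e C), p s :=
  (withDensity_absolutelyContinuous _ _).ae_le h

theorem integrable_sqrtEdgeMeasure {B e C : ℝ} (hC : 0 ≤ C) {f : ℝ → ℝ}
    (hf : IntegrableOn (fun s => √(e - s) * f s) (Ioo B e)) :
    Integrable f (sqrtEdgeMeasure B e C) := by
  rw [sqrtEdgeMeasure, integrable_withDensity_iff_integrable_smul' (measurable_sqrtEdge e C)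
    (by simp)]
  refine (hf.const_mul C).congr (Eventually.of_forall fun s => ?_)
  simp only [smul_eq_mul]
  rw [ENNReal.toReal_ofReal (by positivity), mul_assoc]

theorem integral_sqrtEdgeMeasure {B e C : ℝ} (hC : 0 ≤ C) (f : ℝ → ℝ) :
    ∫ s, f s ∂(sqrtEdgeMeasure B e C) = C * ∫ s in Ioo B e, √(e - s) * f s := by
  rw [sqrtEdgeMeasure, integral_withDensity_eq_integral_toReal_smul (measurable_sqrtEdge e C)
    (by simp), ← integral_const_mul]
  refine integral_congr_ae (Eventually.of_forall fun s => ?_)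
  simp only [smul_eq_mul]
  rw [ENNReal.toReal_ofReal (by positivity), mul_assoc]

theorem integrable_indicator_abs_rpow {r : ℝ} (hr : -1 < r) (L : ℝ) :
    Integrable ((Ioo (-L) L).indicator fun w : ℝ => |w| ^ r) := by
  rw [integrable_indicator_iff measurableSet_Ioo]
  rcases le_or_gt L 0 with hL | hL
  · rw [Ioo_eq_empty (by linarith)]; exact integrableOn_empty
  have h1 : IntervalIntegrable (fun w : ℝ => |w| ^ r) volume 0 L :=
    (intervalIntegral.intervalIntegrable_rpow' hr).congr fun w hw => by
      rw [uIoc_of_le hL.le] at hw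
      simp only [abs_of_pos hw.1]
  have h2 : IntervalIntegrable (fun w : ℝ => |w| ^ r) volume (-L) 0 := by
    have := (IntervalIntegrable.iff_comp_neg (by simp)).1 h1
    simpa using this.symm
  exact ((intervalIntegrable_iff_integrableOn_Ioo_of_le (by linarith)).1 (h2.trans h1))

theorem sqrt_mul_inv_eq_rpow {u : ℝ} (hu : 0 < u) : √u * u⁻¹ = u ^ (-1 / 2 : ℝ) := by
  rw [Real.sqrt_eq_rpow, ← Real.rpow_neg_one, ← Real.rpow_add hu]
  norm_num

theorem integrable_inv_edge {B e C : ℝ} (hC : 0 ≤ C) :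
    Integrable (fun s => (e - s)⁻¹) (sqrtEdgeMeasure B e C) := by
  refine integrable_sqrtEdgeMeasure hC ?_
  have h := ((integrable_indicator_abs_rpow (r := -1 / 2) (by norm_num) (e - B)).comp_sub_left
    e).integrableOn (s := Ioo B e)
  refine h.congr_fun (fun s hs => ?_) measurableSet_Ioo
  have hu : 0 < e - s := sub_pos.2 hs.2
  have : e - s ∈ Ioo (-(e - B)) (e - B) := ⟨by linarith [hs.1], by linarith [hs.1]⟩
  simp only [indicator_of_mem this, abs_of_pos hu, sqrt_mul_inv_eq_rpow hu]

/-- The power `5/4 > 1` will make the error `o(t)`, and `-1/4` keeps the singularity integrable. The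
left side is quadratically small for `x ≤ 1/2`, has a logarithmic pole near `1`, and is negative for
`x > 2`. -/
theorem neg_log_abs_one_sub_le {x : ℝ} (hx : 0 < x) (hx1 : x ≠ 1) :
    -Real.log |1 - x| - x ≤ 10 * x ^ (5 / 4 : ℝ) * |1 - x| ^ (-1 / 4 : ℝ) := by
  have hy : 0 < |1 - x| := abs_pos.2 (sub_ne_zero.2 hx1.symm)
  have hrhs : 0 ≤ 10 * x ^ (5 / 4 : ℝ) * |1 - x| ^ (-1 / 4 : ℝ) := by positivity
  rcases le_or_gt x (1 / 2) with h1 | h1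
  · have habs : |1 - x| = 1 - x := abs_of_pos (by linarith)
    have hpos : 0 < 1 - x := by linarith
    have hlog := Real.one_sub_inv_le_log_of_pos hpos
    have hinv : (1 - x)⁻¹ - 1 - x ≤ 2 * x ^ 2 := by
      have : (1 - x)⁻¹ - 1 - x = x ^ 2 / (1 - x) := by field_simp; ring
      rw [this, div_le_iff₀ hpos]
      nlinarith [sq_nonneg x]
    have hpow : x ^ 2 ≤ x ^ (5 / 4 : ℝ) := by
      rw [← Real.rpow_natCast]
      exact Real.rpow_le_rpow_of_exponent_ge hx (by linarith) (by norm_num)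
    have hone : 1 ≤ |1 - x| ^ (-1 / 4 : ℝ) :=
      Real.one_le_rpow_of_pos_of_le_one_of_nonpos hy (by rw [habs]; linarith) (by norm_num)
    have hx5 : 0 ≤ x ^ (5 / 4 : ℝ) := by positivity
    rw [habs] at hone ⊢
    nlinarith [mul_le_mul_of_nonneg_left hone hx5]
  rcases le_or_gt x 2 with h2 | h2
  · have hlog : -Real.log |1 - x| ≤ 4 * |1 - x| ^ (-1 / 4 : ℝ) := by
      have h := Real.log_le_rpow_div (x := |1 - x|⁻¹) (ε := 1 / 4) (by positivity) (by norm_num)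
      rw [Real.log_inv, Real.inv_rpow hy.le, ← Real.rpow_neg hy.le] at h
      norm_num at h ⊢
      linarith
    -- `10 * (2 / 5)` is the `4` of the logarithmic bound, and `(2 / 5) ^ 4 ≤ (1 / 2) ^ 5`.
    have hpow : (2 / 5 : ℝ) ≤ x ^ (5 / 4 : ℝ) := by
      have h3 : (1 / 2 : ℝ) ^ (5 / 4 : ℝ) ≤ x ^ (5 / 4 : ℝ) :=
        Real.rpow_le_rpow (by norm_num) h1.le (by norm_num)
      refine le_trans ?_ h3
      have h4 : ((2 / 5 : ℝ) ^ (4 : ℝ)) ^ (1 / 4 : ℝ) = 2 / 5 := by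
        rw [← Real.rpow_mul (by norm_num)]; norm_num
      have h5 : ((1 / 2 : ℝ) ^ (5 : ℝ)) ^ (1 / 4 : ℝ) = (1 / 2) ^ (5 / 4 : ℝ) := by
        rw [← Real.rpow_mul (by norm_num)]; norm_num
      rw [← h4, ← h5]
      exact Real.rpow_le_rpow (by positivity) (by norm_num) (by norm_num)
    have hY : 0 ≤ |1 - x| ^ (-1 / 4 : ℝ) := by positivity
    nlinarith [mul_le_mul_of_nonneg_right hpow hY]
  · have : 0 ≤ Real.log |1 - x| := by
      refine Real.log_nonneg ?_
      rw [abs_sub_comm, abs_of_pos (by linarith)]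
      linarith
    linarith

theorem log_sub_log_abs_sub_le {u t : ℝ} (hu : 0 < u) (ht : 0 < t) (hut : u ≠ t) :
    Real.log u - Real.log |u - t| - t * u⁻¹ ≤
      10 * t ^ (5 / 4 : ℝ) * (u⁻¹ * |u - t| ^ (-1 / 4 : ℝ)) := by
  have hx : 0 < t / u := div_pos ht hu
  have hx1 : t / u ≠ 1 := fun h => hut ((div_eq_one_iff_eq hu.ne').1 h).symm
  have h := neg_log_abs_one_sub_le hx hx1
  have hd : 0 < |u - t| := abs_pos.2 (sub_ne_zero.2 hut)
  have habs : |1 - t / u| = |u - t| / u := by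
    rw [← abs_of_pos hu, ← abs_div, abs_of_pos hu, sub_div, div_self hu.ne']
  rw [habs, Real.log_div hd.ne' hu.ne', Real.div_rpow ht.le hu.le,
    Real.div_rpow hd.le hu.le] at h
  have hpow : u ^ (5 / 4 : ℝ) * u ^ (-1 / 4 : ℝ) = u := by
    rw [← Real.rpow_add hu]; norm_num
  calc Real.log u - Real.log |u - t| - t * u⁻¹
      = -(Real.log |u - t| - Real.log u) - t / u := by ring
    _ ≤ _ := h
    _ = 10 * t ^ (5 / 4 : ℝ) * ((u ^ (5 / 4 : ℝ) * u ^ (-1 / 4 : ℝ))⁻¹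
          * |u - t| ^ (-1 / 4 : ℝ)) := by
        rw [mul_inv]; ring
    _ = _ := by rw [hpow]

/-- With `p = u ^ (-1/4)` and `r = v ^ (-1/4)` this is `p² r ≤ p³ + r³`; it separates the two
singularities into integrable ones. -/
theorem sqrt_mul_inv_mul_rpow_le {u v : ℝ} (hu : 0 < u) (hv : 0 < v) :
    √u * (u⁻¹ * v ^ (-1 / 4 : ℝ)) ≤ u ^ (-3 / 4 : ℝ) + v ^ (-3 / 4 : ℝ) := by
  have h1 : ∀ {w : ℝ}, 0 < w → w ^ (-3 / 4 : ℝ) = (w ^ (-1 / 4 : ℝ)) ^ 3 := fun {w} hw => by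
    rw [← Real.rpow_natCast, ← Real.rpow_mul hw.le]; norm_num
  have h2 : √u * u⁻¹ = (u ^ (-1 / 4 : ℝ)) ^ 2 := by
    rw [sqrt_mul_inv_eq_rpow hu, ← Real.rpow_natCast, ← Real.rpow_mul hu.le]; norm_num
  rw [← mul_assoc, h2, h1 hu, h1 hv]
  have hp : 0 ≤ u ^ (-1 / 4 : ℝ) := by positivity
  have hr : 0 ≤ v ^ (-1 / 4 : ℝ) := by positivity
  generalize u ^ (-1 / 4 : ℝ) = p at *
  generalize v ^ (-1 / 4 : ℝ) = r at *
  rcases le_total p r with hpr | hpr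
  · nlinarith [mul_le_mul_of_nonneg_right (pow_le_pow_left₀ hp hpr 2) hr, pow_nonneg hp 3]
  · nlinarith [mul_le_mul_of_nonneg_left hpr (pow_nonneg hp 2), pow_nonneg hr 3]

/-- One-sided estimate of the logarithmic potential to the left of a soft edge. -/
theorem exists_logPotential_sub_le {μ : Measure ℝ} {B e C : ℝ} (hC : 0 ≤ C)
    (hμ : μ ≤ sqrtEdgeMeasure B e C)
    (hlog : ∀ x : ℝ, Integrable (fun s => Real.log |x - s|) μ) :
    ∃ K, ∀ t, 0 < t → t < e - B →
      logPotential μ e - logPotential μ (e - t) ≤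
        t * ∫ s, (e - s)⁻¹ ∂μ + K * t ^ (5 / 4 : ℝ) := by
  -- The error is dominated by two reflected translates of `f₀`, whose integrals do not depend on
  -- `t`; hence neither does `K`.
  set f₀ : ℝ → ℝ := (Ioo (-(e - B)) (e - B)).indicator fun w => |w| ^ (-3 / 4 : ℝ) with hf₀
  have hint : Integrable f₀ := integrable_indicator_abs_rpow (by norm_num) _
  have hf₀0 : ∀ w, 0 ≤ f₀ w := fun w => indicator_nonneg (fun w _ => by positivity) w
  refine ⟨10 * (C * (2 * ∫ w, f₀ w)), fun t ht htB => ?_⟩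
  set F : ℝ → ℝ := fun s => (e - s)⁻¹ * |e - s - t| ^ (-1 / 4 : ℝ) with hF
  have hgen : ∀ᵐ s ∂(volume.restrict (Ioo B e)), s ∈ Ioo B e ∧ e - s ≠ t := by
    refine (ae_restrict_mem measurableSet_Ioo).and (ae_restrict_of_ae ?_)
    filter_upwards [Measure.ae_ne volume (e - t)] with s hs hst
    exact hs (by linarith)
  have hFm : Measurable F := by
    refine Measurable.mul (by fun_prop) (Measurable.pow_const (by fun_prop) _)
  have hG : Integrable fun s => f₀ (e - s) + f₀ (e - t - s) :=
    (hint.comp_sub_left e).add (hint.comp_sub_left (e - t))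
  have hFG : ∀ᵐ s ∂(volume.restrict (Ioo B e)),
      √(e - s) * F s ≤ f₀ (e - s) + f₀ (e - t - s) := by
    filter_upwards [hgen] with s hs
    have hu : 0 < e - s := sub_pos.2 hs.1.2
    have hv : 0 < |e - s - t| := abs_pos.2 (sub_ne_zero.2 hs.2)
    have m1 : e - s ∈ Ioo (-(e - B)) (e - B) := ⟨by linarith [hs.1.1], by linarith [hs.1.1]⟩
    have m2 : e - t - s ∈ Ioo (-(e - B)) (e - B) :=
      ⟨by linarith, by linarith [hs.1.1]⟩
    have heq : e - t - s = e - s - t := by ring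
    rw [hf₀, indicator_of_mem m1, indicator_of_mem m2, heq, abs_of_pos hu]
    exact sqrt_mul_inv_mul_rpow_le hu hv
  have hF0 : ∀ᵐ s ∂(volume.restrict (Ioo B e)), 0 ≤ F s := by
    filter_upwards [hgen] with s hs
    have hu : 0 < e - s := sub_pos.2 hs.1.2
    positivity
  have hFi' : IntegrableOn (fun s => √(e - s) * F s) (Ioo B e) := by
    refine hG.integrableOn.mono' ((by fun_prop : Measurable fun s => √(e - s)).mul
      hFm).aestronglyMeasurable ?_
    filter_upwards [hFG, hF0] with s h1 h2
    rwa [Real.norm_of_nonneg (by positivity)]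
  have hFi := integrable_sqrtEdgeMeasure hC hFi'
  have hinv := (integrable_inv_edge (B := B) (e := e) hC).mono_measure hμ
  have hFint : ∫ s, F s ∂μ ≤ C * (2 * ∫ w, f₀ w) := by
    refine (integral_mono_measure hμ (ae_sqrtEdgeMeasure hF0) hFi).trans ?_
    rw [integral_sqrtEdgeMeasure hC]
    refine mul_le_mul_of_nonneg_left ?_ hC
    refine (integral_mono_ae hFi' hG.integrableOn hFG).trans ?_
    refine (setIntegral_le_integral hG (Eventually.of_forall fun s =>
      add_nonneg (hf₀0 _) (hf₀0 _))).trans_eq ?_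
    rw [integral_add (hint.comp_sub_left e) (hint.comp_sub_left (e - t)),
      integral_sub_left_eq_self, integral_sub_left_eq_self, two_mul]
  have hgenμ : ∀ᵐ s ∂μ, s ∈ Ioo B e ∧ e - s ≠ t :=
    (Measure.absolutelyContinuous_of_le hμ).ae_le (ae_sqrtEdgeMeasure hgen)
  have hpt : ∀ᵐ s ∂μ, Real.log |e - s| - Real.log |e - t - s| ≤
      t * (e - s)⁻¹ + 10 * t ^ (5 / 4 : ℝ) * F s := by
    filter_upwards [hgenμ] with s hs
    have hu : 0 < e - s := sub_pos.2 hs.1.2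
    have h := log_sub_log_abs_sub_le hu ht hs.2
    rw [abs_of_pos hu, show e - t - s = e - s - t by ring]
    exact sub_le_iff_le_add'.1 h
  have hFμ : Integrable F μ := hFi.mono_measure hμ
  have hmono := integral_mono_ae ((hlog e).sub (hlog (e - t)))
    ((hinv.const_mul t).add (hFμ.const_mul (10 * t ^ (5 / 4 : ℝ)))) hpt
  simp only [Pi.sub_apply, Pi.add_apply] at hmono
  rw [integral_sub (hlog e) (hlog (e - t)),
    integral_add (hinv.const_mul t) (hFμ.const_mul _), integral_const_mul,
    integral_const_mul] at hmono
  unfold logPotential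
  have ht5 : 0 ≤ 10 * t ^ (5 / 4 : ℝ) := by positivity
  have := mul_le_mul_of_nonneg_left hFint ht5
  linarith

/-! ### The Stieltjes transform and the slope at the edge -/

/-- The Stieltjes transform `x ↦ ∫ (x - s)⁻¹ dμ(s)` on the real line. -/
noncomputable def stieltjes (μ : Measure ℝ) (x : ℝ) : ℝ :=
  ∫ s, (x - s)⁻¹ ∂μ

theorem gFun_eq_logPotential (μ : Measure ℝ) : gFun μ = logPotential μ := by
  funext x
  simp only [gFun, logPotential, Real.log_abs]

section Stieltjes

variable {μ : Measure ℝ} {e : ℝ}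

theorem integral_pos_of_ae_pos [IsProbabilityMeasure μ] {f : ℝ → ℝ} (hf : Integrable f μ)
    (hpos : ∀ᵐ s ∂μ, 0 < f s) : 0 < ∫ s, f s ∂μ := by
  rw [integral_pos_iff_support_of_nonneg_ae (hpos.mono fun _ h => h.le) hf]
  have : μ (Function.support f) = 1 := by
    rw [← measure_univ (μ := μ)]
    exact measure_congr (eventuallyEq_univ.2 (hpos.mono fun _ h => h.ne'))
  rw [this]
  exact one_pos

theorem integrable_inv_of_edge_le (hlt : ∀ᵐ s ∂μ, s < e)
    (hint : Integrable (fun s => (e - s)⁻¹) μ) {x : ℝ} (hx : e ≤ x) :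
    Integrable (fun s => (x - s)⁻¹) μ := by
  refine hint.mono' (by fun_prop : Measurable fun s => (x - s)⁻¹).aestronglyMeasurable ?_
  filter_upwards [hlt] with s hs
  rw [Real.norm_of_nonneg (inv_nonneg.2 (by linarith))]
  exact inv_anti₀ (sub_pos.2 hs) (by linarith)

theorem stieltjes_pos [IsProbabilityMeasure μ] (hlt : ∀ᵐ s ∂μ, s < e)
    (hint : Integrable (fun s => (e - s)⁻¹) μ) {x : ℝ} (hx : e ≤ x) : 0 < stieltjes μ x :=
  integral_pos_of_ae_pos (integrable_inv_of_edge_le hlt hint hx)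
    (hlt.mono fun s hs => inv_pos.2 (by linarith))

theorem stieltjes_strictAntiOn [IsProbabilityMeasure μ] (hlt : ∀ᵐ s ∂μ, s < e)
    (hint : Integrable (fun s => (e - s)⁻¹) μ) : StrictAntiOn (stieltjes μ) (Ici e) := by
  intro x hx y hy hxy
  have hxi := integrable_inv_of_edge_le hlt hint hx
  have hyi := integrable_inv_of_edge_le hlt hint hy
  rw [← sub_pos, stieltjes, stieltjes, ← integral_sub hxi hyi]
  refine integral_pos_of_ae_pos (hxi.sub hyi) ?_
  filter_upwards [hlt] with s hs
  have hx' : e ≤ x := hx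
  exact sub_pos.2 (inv_strictAnti₀ (by linarith) (by linarith))

theorem stieltjes_continuousOn (hlt : ∀ᵐ s ∂μ, s < e)
    (hint : Integrable (fun s => (e - s)⁻¹) μ) : ContinuousOn (stieltjes μ) (Ici e) := by
  refine continuousOn_of_dominated (bound := fun s => (e - s)⁻¹)
    (fun x hx => (integrable_inv_of_edge_le hlt hint hx).aestronglyMeasurable)
    (fun x hx => ?_) hint ?_
  · filter_upwards [hlt] with s hs
    have hx' : e ≤ x := hx
    rw [Real.norm_of_nonneg (inv_nonneg.2 (by linarith))]
    exact inv_anti₀ (sub_pos.2 hs) (by linarith)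
  · filter_upwards [hlt] with s hs
    refine ContinuousOn.inv₀ (by fun_prop) fun x hx => ?_
    have hx' : e ≤ x := hx
    exact (by linarith : (0 : ℝ) < x - s).ne'

theorem stieltjes_tendsto [IsProbabilityMeasure μ] (hlt : ∀ᵐ s ∂μ, s < e)
    (hint : Integrable (fun s => (e - s)⁻¹) μ) : Tendsto (stieltjes μ) atTop (𝓝 0) := by
  have hup : Tendsto (fun x : ℝ => (x - e)⁻¹) atTop (𝓝 0) :=
    tendsto_inv_atTop_zero.comp (tendsto_atTop_add_const_right _ (-e) tendsto_id)
  refine tendsto_of_tendsto_of_tendsto_of_le_of_le' tendsto_const_nhds hup ?_ ?_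
  · filter_upwards [eventually_ge_atTop e] with x hx using (stieltjes_pos hlt hint hx).le
  · filter_upwards [eventually_gt_atTop e] with x hx
    have h := integral_mono_ae (integrable_inv_of_edge_le hlt hint hx.le)
      (integrable_const (x - e)⁻¹) (by
        filter_upwards [hlt] with s hs
        exact inv_anti₀ (sub_pos.2 hx) (by linarith))
    simpa [stieltjes] using h

/-- Integrate `1 - r⁻¹ ≤ log r ≤ r - 1` at `r = (x - s) / (y - s)`. -/
theorem gFun_secant (hlt : ∀ᵐ s ∂μ, s < e) (hint : Integrable (fun s => (e - s)⁻¹) μ)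
    (hlog : ∀ x : ℝ, Integrable (fun s => Real.log |x - s|) μ) {x y : ℝ} (hy : e ≤ y)
    (hxy : y < x) :
    (x - y) * stieltjes μ x ≤ gFun μ x - gFun μ y ∧
      gFun μ x - gFun μ y ≤ (x - y) * stieltjes μ y := by
  have hxi := integrable_inv_of_edge_le hlt hint (hy.trans hxy.le)
  have hyi := integrable_inv_of_edge_le hlt hint hy
  have hpt : ∀ᵐ s ∂μ, (x - y) * (x - s)⁻¹ ≤ Real.log |x - s| - Real.log |y - s| ∧
      Real.log |x - s| - Real.log |y - s| ≤ (x - y) * (y - s)⁻¹ := by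
    filter_upwards [hlt] with s hs
    have h1 : 0 < y - s := by linarith
    have h2 : 0 < x - s := by linarith
    rw [abs_of_pos h1, abs_of_pos h2, ← Real.log_div h2.ne' h1.ne']
    have hd : 0 < (x - s) / (y - s) := div_pos h2 h1
    have e1 : (x - y) * (x - s)⁻¹ = 1 - ((x - s) / (y - s))⁻¹ := by field_simp; ring
    have e2 : (x - y) * (y - s)⁻¹ = (x - s) / (y - s) - 1 := by field_simp; ring
    exact ⟨e1 ▸ Real.one_sub_inv_le_log_of_pos hd, e2 ▸ Real.log_le_sub_one_of_pos hd⟩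
  rw [gFun_eq_logPotential, logPotential, logPotential, ← integral_sub (hlog x) (hlog y),
    stieltjes, stieltjes, ← integral_const_mul, ← integral_const_mul]
  exact ⟨integral_mono_ae (hxi.const_mul _) ((hlog x).sub (hlog y)) (hpt.mono fun _ h => h.1),
    integral_mono_ae ((hlog x).sub (hlog y)) (hyi.const_mul _) (hpt.mono fun _ h => h.2)⟩

end Stieltjes

theorem eventually_mul_le_of_growth {V : ℝ → ℝ}
    (hgrowth : Tendsto (fun x : ℝ => V x / Real.sqrt (x ^ 2 + 1)) (cocompact ℝ) atTop) (M : ℝ) :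
    ∀ᶠ x in atTop, M * x ≤ V x := by
  filter_upwards [(hgrowth.mono_left atTop_le_cocompact).eventually_ge_atTop |M|,
    eventually_ge_atTop 0] with x hx hx0
  have hpos : 0 < √(x ^ 2 + 1) := by positivity
  rw [le_div_iff₀ hpos] at hx
  have h1 : x ≤ √(x ^ 2 + 1) := Real.le_sqrt_of_sq_le (by linarith)
  calc M * x ≤ |M| * x := mul_le_mul_of_nonneg_right (le_abs_self M) hx0
    _ ≤ |M| * √(x ^ 2 + 1) := mul_le_mul_of_nonneg_left h1 (abs_nonneg M)
    _ ≤ V x := hx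

/-- The derivative of the logarithmic potential at a soft edge is half that of the external
field, by the variational equality to the left of the edge and the inequality to its right. -/
theorem stieltjes_edge {V : ℝ → ℝ} {μ : Measure ℝ} {B e C ℓ : ℝ} (hBe : B < e) (hC : 0 ≤ C)
    (hμ : μ ≤ sqrtEdgeMeasure B e C) (hlt : ∀ᵐ s ∂μ, s < e)
    (hlog : ∀ x : ℝ, Integrable (fun s => Real.log |x - s|) μ)
    (hV : DifferentiableAt ℝ V e) (hedge : 2 * logPotential μ e - V e = ℓ)
    (hband : ∀ᶠ x in 𝓝[<] e, 2 * logPotential μ x - V x = ℓ)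
    (hoff : ∀ x, e < x → 2 * logPotential μ x - V x < ℓ) :
    stieltjes μ e = deriv V e / 2 := by
  have hint : Integrable (fun s => (e - s)⁻¹) μ := (integrable_inv_edge hC).mono_measure hμ
  have hVs := hasDerivAt_iff_tendsto_slope.1 hV.hasDerivAt
  apply le_antisymm
  -- To the right, `(x - e) q x ≤ g x - g e < (V x - V e) / 2`; divide by `x - e` and let `x ↓ e`.
  · have hVr : Tendsto (slope V e) (𝓝[>] e) (𝓝 (deriv V e)) :=
      hVs.mono_left (nhdsWithin_mono _ fun x hx => ne_of_gt hx)
    have hqr : Tendsto (stieltjes μ) (𝓝[>] e) (𝓝 (stieltjes μ e)) :=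
      (stieltjes_continuousOn hlt hint e self_mem_Ici).mono_left
        (nhdsWithin_mono _ Ioi_subset_Ici_self)
    refine le_of_tendsto_of_tendsto hqr (hVr.div_const 2) ?_
    filter_upwards [self_mem_nhdsWithin] with x hx
    replace hx : e < x := hx
    have h1 := (gFun_secant hlt hint hlog le_rfl hx).1
    rw [gFun_eq_logPotential] at h1
    have h2 := hoff x hx
    rw [slope_def_field, div_div, le_div_iff₀ (by linarith)]
    linarith
  -- To the left, `V e - V x` equals twice the potential difference; after division by `t = e - x`
  -- the error is `K t ^ (1/4) → 0`.
  · obtain ⟨K, hK⟩ := exists_logPotential_sub_le hC hμ hlog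
    have hVl : Tendsto (slope V e) (𝓝[<] e) (𝓝 (deriv V e)) :=
      hVs.mono_left (nhdsWithin_mono _ fun x hx => ne_of_lt hx)
    have hup : Tendsto (fun x => stieltjes μ e + K * (e - x) ^ (1 / 4 : ℝ)) (𝓝[<] e)
        (𝓝 (stieltjes μ e)) := by
      have hc : Continuous fun x : ℝ => stieltjes μ e + K * (e - x) ^ (1 / 4 : ℝ) :=
        continuous_const.add (continuous_const.mul
          ((continuous_const.sub continuous_id).rpow_const fun _ => Or.inr (by norm_num)))
      have := (hc.tendsto e).mono_left (nhdsWithin_le_nhds (s := Iio e))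
      simpa using this
    refine le_of_tendsto_of_tendsto (hVl.div_const 2) hup ?_
    filter_upwards [self_mem_nhdsWithin, hband, Ioo_mem_nhdsLT hBe] with x hx hxb hxB
    replace hx : x < e := hx
    have ht : 0 < e - x := sub_pos.2 hx
    have h1 := hK (e - x) ht (by linarith [hxB.1])
    have h2 : (e - x) ^ (5 / 4 : ℝ) = (e - x) * (e - x) ^ (1 / 4 : ℝ) := by
      rw [show (5 / 4 : ℝ) = 1 + 1 / 4 by norm_num, Real.rpow_add ht, Real.rpow_one]
    rw [sub_sub_cancel, h2] at h1
    have h3 : slope V e x / 2 = (V e - V x) / (2 * (e - x)) := by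
      rw [slope_comm, slope_def_field, div_div, mul_comm]
    change slope V e x / 2 ≤ stieltjes μ e + K * (e - x) ^ (1 / 4 : ℝ)
    rw [h3, div_le_iff₀ (by linarith)]
    unfold stieltjes
    linarith

/-! ### Support and density of the equilibrium measure -/

section Bands

variable {N : ℕ} {b a : Fin (N + 1) → ℝ}

theorem norm_sqrtR (x : ℝ) :
    ‖sqrtR b a (x : ℂ)‖ = ∏ j, √|x - b j| * √|x - a j| := by
  have key : ∀ c : ℝ, ‖((x : ℂ) - (c : ℂ)) ^ (1 / 2 : ℂ)‖ = √|x - c| := fun c => by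
    rw [show (1 / 2 : ℂ) = ((1 / 2 : ℝ) : ℂ) by norm_num, Complex.norm_cpow_real,
      ← Complex.ofReal_sub, Complex.norm_real, Real.sqrt_eq_rpow, Real.norm_eq_abs]
  rw [sqrtR, norm_prod]
  exact Finset.prod_congr rfl fun j _ => by rw [norm_mul, key, key]

theorem isOpen_bands : IsOpen (bands b a) := isOpen_iUnion fun _ => isOpen_Ioo

namespace HasBandDensity

variable {μ : Measure ℝ} {h Ψ : ℝ → ℝ}

theorem le_last (H : HasBandDensity μ b a h Ψ) (j : Fin (N + 1)) : a j ≤ a (Fin.last N) := by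
  rcases (Fin.le_last j).eq_or_lt with rfl | hj
  · rfl
  · exact ((H.right_lt_left _ _ hj).trans (H.left_lt_right _)).le

theorem zero_le (H : HasBandDensity μ b a h Ψ) (j : Fin (N + 1)) : b 0 ≤ b j := by
  rcases (Fin.zero_le j).eq_or_lt with rfl | hj
  · rfl
  · exact ((H.left_lt_right _).trans (H.right_lt_left _ _ hj)).le

theorem bands_subset (H : HasBandDensity μ b a h Ψ) :
    bands b a ⊆ Ioo (b 0) (a (Fin.last N)) :=
  iUnion_subset fun j => Ioo_subset_Ioo (H.zero_le j) (H.le_last j)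

theorem zero_lt_last (H : HasBandDensity μ b a h Ψ) : b 0 < a (Fin.last N) :=
  (H.zero_le _).trans_lt (H.left_lt_right _)

theorem last_subset_bands : Ioo (b (Fin.last N)) (a (Fin.last N)) ⊆ bands b a :=
  subset_iUnion (fun j => Ioo (b j) (a j)) (Fin.last N)

/-- A nonnegative density equals its modulus, so neither the phase of the square root nor the sign
of `h` has to be tracked. -/
theorem density_eq (H : HasBandDensity μ b a h Ψ) {x : ℝ} (hx : x ∈ bands b a) :
    Ψ x = (2 * Real.pi)⁻¹ * (∏ j, √|x - b j| * √|x - a j|) * |h x| := by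
  have h1 : ‖(Ψ x : ℂ)‖ = Ψ x := by
    rw [Complex.norm_real, Real.norm_of_nonneg (H.nonneg x hx)]
  rw [← h1, H.formula x hx, norm_mul, norm_mul, norm_sqrtR]
  simp [abs_of_pos Real.pi_pos]

theorem continuous_h (H : HasBandDensity μ b a h Ψ) : Continuous h :=
  continuous_iff_continuousAt.2 fun x => (H.analytic x (mem_univ x)).continuousAt

/-- Apart from the factor `√(a_N - x)`, the density formula is continuous on the compact hull of the
bands, hence bounded there. -/
theorem le_sqrtEdgeMeasure (H : HasBandDensity μ b a h Ψ) :
    ∃ C, 0 ≤ C ∧ μ ≤ sqrtEdgeMeasure (b 0) (a (Fin.last N)) C := by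
  have hh := H.continuous_h
  set k : ℝ → ℝ := fun x => (2 * Real.pi)⁻¹ *
    ((∏ j : Fin N, √|x - b j.castSucc| * √|x - a j.castSucc|) * √|x - b (Fin.last N)|) * |h x|
    with hk
  have hkc : Continuous k := by fun_prop
  obtain ⟨C, hC⟩ := (isCompact_Icc (a := b 0) (b := a (Fin.last N))).exists_bound_of_continuousOn
    hkc.continuousOn
  refine ⟨C, (norm_nonneg _).trans (hC (b 0) ⟨le_rfl, H.zero_lt_last.le⟩), ?_⟩
  rw [H.measure_eq, sqrtEdgeMeasure, ← withDensity_indicator isOpen_bands.measurableSet,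
    ← withDensity_indicator measurableSet_Ioo]
  refine withDensity_mono (Eventually.of_forall fun x => ?_)
  by_cases hx : x ∈ bands b a
  · have hx' := H.bands_subset hx
    rw [indicator_of_mem hx, indicator_of_mem hx']
    refine ENNReal.ofReal_le_ofReal ?_
    have h1 := (le_abs_self _).trans (hC x ⟨hx'.1.le, hx'.2.le⟩)
    have h2 : Ψ x = k x * √(a (Fin.last N) - x) := by
      rw [H.density_eq hx, Fin.prod_univ_castSucc, abs_sub_comm x (a (Fin.last N)),
        abs_of_pos (sub_pos.2 hx'.2)]
      simp only [hk]
      ring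
    rw [h2]
    exact mul_le_mul_of_nonneg_right h1 (Real.sqrt_nonneg _)
  · rw [indicator_of_notMem hx]
    exact bot_le

theorem density_pos (H : HasBandDensity μ b a h Ψ) (hne : ∀ x ∈ closure (bands b a), h x ≠ 0)
    {x : ℝ} (hx : x ∈ bands b a) : 0 < Ψ x := by
  refine lt_of_le_of_ne (H.nonneg x hx) fun h0 => ?_
  rw [H.density_eq hx] at h0
  obtain ⟨i, hi⟩ := mem_iUnion.1 hx
  have hprod : ∀ j, 0 < √|x - b j| * √|x - a j| := fun j => by
    have hxa : x ≠ a j := by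
      rintro rfl
      rcases lt_trichotomy i j with hij | rfl | hij
      · linarith [hi.2, H.right_lt_left _ _ hij, H.left_lt_right j]
      · exact hi.2.false
      · linarith [hi.1, H.right_lt_left _ _ hij]
    have hxb : x ≠ b j := by
      rintro rfl
      rcases lt_trichotomy i j with hij | rfl | hij
      · linarith [hi.2, H.right_lt_left _ _ hij]
      · exact hi.1.false
      · linarith [hi.1, H.right_lt_left _ _ hij, H.left_lt_right j]
    have := abs_pos.2 (sub_ne_zero.2 hxa)
    have := abs_pos.2 (sub_ne_zero.2 hxb)
    positivity
  have hp : 0 < ∏ j, √|x - b j| * √|x - a j| := Finset.prod_pos fun j _ => hprod j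
  have hh : 0 < |h x| := abs_pos.2 (hne x (subset_closure hx))
  have hpi := Real.pi_pos
  have : 0 < (2 * Real.pi)⁻¹ * (∏ j, √|x - b j| * √|x - a j|) * |h x| := by positivity
  exact this.ne h0

theorem bands_subset_support (H : HasBandDensity μ b a h Ψ)
    (hne : ∀ x ∈ closure (bands b a), h x ≠ 0) : bands b a ⊆ μ.support := by
  intro x hx
  rw [Measure.mem_support_iff_forall]
  intro U hU
  by_contra hU0
  replace hU0 : μ U = 0 := by simpa using hU0
  -- `Ψ` is constrained only on the bands, so it is replaced by a globally measurable version.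
  set p : ℝ → ENNReal := fun x => ENNReal.ofReal
    ((2 * Real.pi)⁻¹ * (∏ j, √|x - b j| * √|x - a j|) * |h x|) with hp
  have hpm : Measurable p := by
    have hh := H.continuous_h
    exact ENNReal.measurable_ofReal.comp (by fun_prop : Continuous _).measurable
  have hμp : μ = (volume.restrict (bands b a)).withDensity p := by
    rw [H.measure_eq]
    refine withDensity_congr_ae ?_
    filter_upwards [ae_restrict_mem isOpen_bands.measurableSet] with y hy
    rw [H.density_eq hy]
  obtain ⟨W, hWU, hWo, hxW⟩ := mem_nhds_iff.1 (inter_mem hU (isOpen_bands.mem_nhds hx))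
  have hW0 : μ W = 0 := measure_mono_null (hWU.trans inter_subset_left) hU0
  rw [hμp, withDensity_apply_eq_zero hpm] at hW0
  have hsub : W ⊆ {y | p y ≠ 0} ∩ W := fun y hy => by
    refine ⟨?_, hy⟩
    have hyb : y ∈ bands b a := (hWU hy).2
    have := H.density_pos hne hyb
    rw [H.density_eq hyb] at this
    exact (ENNReal.ofReal_pos.2 this).ne'
  have hW1 := measure_mono_null hsub hW0
  rw [Measure.restrict_apply hWo.measurableSet, inter_eq_left.2 (hWU.trans inter_subset_right)]
    at hW1
  exact (hWo.measure_pos volume ⟨x, hxW⟩).ne' hW1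

theorem ae_lt_last (H : HasBandDensity μ b a h Ψ) : ∀ᵐ s ∂μ, s < a (Fin.last N) := by
  rw [H.measure_eq]
  refine (withDensity_absolutelyContinuous _ _).ae_le ?_
  filter_upwards [ae_restrict_mem isOpen_bands.measurableSet] with s hs
  exact (H.bands_subset hs).2

theorem isLUB_support (H : HasBandDensity μ b a h Ψ)
    (hne : ∀ x ∈ closure (bands b a), h x ≠ 0) : IsLUB μ.support (a (Fin.last N)) := by
  constructor
  · exact Measure.support_subset_of_isClosed isClosed_Iic (H.ae_lt_last.mono fun _ h => h.le)
  · intro u hu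
    exact (isLUB_Ioo (H.left_lt_right (Fin.last N))).2 fun x hx =>
      hu (H.bands_subset_support hne (last_subset_bands hx))

end HasBandDensity

end Bands

/-! ### From regularity to the soft edge, and the theorem -/

/-- A regular potential has a soft right-most edge. -/
theorem isSoftEdge_of_isRegular {V : ℝ → ℝ} (hV : AnalyticOnNhd ℝ V univ)
    (hgrowth : Tendsto (fun x : ℝ => V x / Real.sqrt (x ^ 2 + 1)) (cocompact ℝ) atTop)
    {μ : Measure ℝ} {ℓ : ℝ} (hμ : IsEquilibriumMeasure V μ ℓ) (hreg : IsRegular V μ ℓ) :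
    IsSoftEdge V μ (stieltjes μ) ℓ := by
  obtain ⟨N, b, a, h, Ψ, H, hne, hoff⟩ := hreg
  have := hμ.isProbabilityMeasure
  obtain ⟨C, hC, hle⟩ := H.le_sqrtEdgeMeasure
  have hLUB := H.isLUB_support hne
  have hedge : rightEdge μ = a (Fin.last N) :=
    hLUB.csSup_eq (Measure.nonempty_support (IsProbabilityMeasure.ne_zero μ))
  have hmem : a (Fin.last N) ∈ μ.support :=
    hLUB.mem_of_isClosed (Measure.nonempty_support (IsProbabilityMeasure.ne_zero μ))
      Measure.isClosed_support
  have hlt := H.ae_lt_last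
  have hint : Integrable (fun s => (a (Fin.last N) - s)⁻¹) μ :=
    (integrable_inv_edge hC).mono_measure hle
  have hoff' : ∀ x, a (Fin.last N) < x → 2 * logPotential μ x - V x < ℓ := fun x hx =>
    hoff x fun hxc => hx.not_ge
      (closure_minimal (fun y hy => (H.bands_subset hy).2.le) isClosed_Iic hxc)
  have hdiff : Differentiable ℝ V := fun x => (hV x (mem_univ x)).differentiableAt
  have hband : ∀ᶠ x in 𝓝[<] (a (Fin.last N)), 2 * logPotential μ x - V x = ℓ := by
    filter_upwards [Ioo_mem_nhdsLT (H.left_lt_right (Fin.last N))] with x hx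
    exact hμ.eq_on_support x
      (H.bands_subset_support hne (HasBandDensity.last_subset_bands hx))
  unfold IsSoftEdge
  rw [hedge]
  exact
    { slope_pos := fun x hx => stieltjes_pos hlt hint hx
      slope_anti := stieltjes_strictAntiOn hlt hint
      slope_cont := stieltjes_continuousOn hlt hint
      slope_tendsto := stieltjes_tendsto hlt hint
      le_secant := fun x y hy hxy => (gFun_secant hlt hint hμ.integrable_log hy hxy).1
      secant_le := fun x y hy hxy => (gFun_secant hlt hint hμ.integrable_log hy hxy).2
      slope_edge := stieltjes_edge H.zero_lt_last hC hle hlt hμ.integrable_log (hdiff _)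
        (hμ.eq_on_support _ hmem) hband hoff'
      eq_edge := by rw [gFun_eq_logPotential]; exact hμ.eq_on_support _ hmem
      lt_off_edge := fun x hx => by rw [gFun_eq_logPotential]; exact hoff' x hx
      differentiable := hdiff
      growth := eventually_mul_le_of_growth hgrowth }

end SpikedSource

open SpikedSource in
theorem lemma1p2 (V : ℝ → ℝ) (hV : AnalyticOnNhd ℝ V univ)
    (hgrowth : Tendsto (fun x : ℝ => V x / Real.sqrt (x ^ 2 + 1)) (cocompact ℝ) atTop)
    (μ : Measure ℝ) (ℓ : ℝ) (hμ : IsEquilibriumMeasure V μ ℓ) (hreg : IsRegular V μ ℓ) :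
    -- (a)
    (Ioi (deriv V (rightEdge μ) / 2) ⊆ setA V μ ℓ ∧
      aCrit V μ ℓ ≤ deriv V (rightEdge μ) / 2) ∧
    -- (b)
    setA V μ ℓ = Ioi (aCrit V μ ℓ) ∧
    -- (c)
    0 < aCrit V μ ℓ ∧
    -- (d)
    (∀ a, 0 < a → a < aCrit V μ ℓ →
      ∀ x, cPoint V μ a < x → GFun V μ x a < HFun μ ℓ (cPoint V μ a) a) ∧
    -- (e)
    (ConvexOn ℝ (Ici (rightEdge μ)) V →
      aCrit V μ ℓ = deriv V (rightEdge μ) / 2 ∧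
      (∀ x, rightEdge μ < x →
        GFun V μ x (aCrit V μ ℓ) < HFun μ ℓ (rightEdge μ) (aCrit V μ ℓ)) ∧
      cPoint V μ (aCrit V μ ℓ) = rightEdge μ ∧
      GFun V μ (rightEdge μ) (aCrit V μ ℓ) = HFun μ ℓ (rightEdge μ) (aCrit V μ ℓ)) ∧
    -- (f)
    (aCrit V μ ℓ < deriv V (rightEdge μ) / 2 →
      (∀ x, cPoint V μ (aCrit V μ ℓ) < x →
        GFun V μ x (aCrit V μ ℓ) ≤ HFun μ ℓ (cPoint V μ (aCrit V μ ℓ)) (aCrit V μ ℓ)) ∧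
      ∃ x, cPoint V μ (aCrit V μ ℓ) < x ∧
        GFun V μ x (aCrit V μ ℓ) = HFun μ ℓ (cPoint V μ (aCrit V μ ℓ)) (aCrit V μ ℓ)) := by
  have h := isSoftEdge_of_isRegular hV hgrowth hμ hreg
  refine ⟨⟨h.Ioi_subset_setA, h.aCrit_le⟩, h.setA_eq_Ioi, h.aCrit_pos,
    fun a ha hac x hx => h.GFun_lt_of_lt_aCrit ha hac hx, fun hconv => ?_,
    fun hlt => ⟨fun x hx => h.GFun_aCrit_le hx, h.exists_GFun_aCrit_eq hlt⟩⟩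
  have hac := h.aCrit_eq_of_convexOn hconv
  refine ⟨hac, fun x hx => ?_, h.cPoint_eq (h.slope_edge.trans hac.symm).le, h.GFun_edge _⟩
  rw [hac]
  exact h.GFun_lt_of_convexOn hconv hx
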